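/- Let $X$ be a real Hausdorff locally convex topological vector space, let $n\ge 1$, and let $f_1,\dots,f_n:X\to\overline{\mathbb R}=\mathbb R\cup\{-\infty,+\infty\}$ be convex, i.e. each epigraph $\{(x,r)\in X\times\mathbb R: f_k(x)\le r\}$ is convex. Put $f:=\max_{1\le k\le n}f_k$ and suppose that $\operatorname{dom} f:=\{x\in X: f(x)<+\infty\}\ne\emptyset$. Assume that at least one of the following holds: (i) every $f_k$ is proper, i.e. $\operatorname{dom} f_k\neq\emptyset$ and $f_k(x)>-\infty$ for all $x\in X$; (ii) every $f_k$ is lower semicontinuous. Then, with $\Delta_n:=\{\lambda\in\mathbb R^n:\lambda_k\ge 0,\ \sum_{k=1}^n\lambda_k=1\}$ and the conventions $(+\infty)+(-\infty)=(-\infty)+(+\infty)=+\infty$, $0\cdot(+\infty)=+\infty$, $0\cdot(-\infty)=0$, $$\inf_{x\in X} f(x)=\max_{\lambda\in\Delta_n}\ \inf_{x\in X}\ \sum_{k=1}^n\lambda_k f_k(x),$$ where the maximum over $\Delta_n$ is attained. -/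

import Mathlib

noncomputable section

namespace ExtConvex

/-- Effective domain of an extended real-valued function. -/
def dom {X : Type*} (f : X → EReal) : Set X := {x | f x < ⊤}

/-- Epigraph of an extended real-valued function, as a subset of `X × ℝ`. -/
def epi {X : Type*} (f : X → EReal) : Set (X × ℝ) := {p | f p.1 ≤ (p.2 : EReal)}

/-- An extended real-valued function is convex if its epigraph is convex. -/
def IsConvex {X : Type*} [AddCommGroup X] [Module ℝ X] (f : X → EReal) : Prop :=
  Convex ℝ (epi f)

/-- Proper: finite somewhere (nonempty domain) and never `-∞`. -/
def IsProper {X : Type*} (f : X → EReal) : Prop :=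
  (dom f).Nonempty ∧ ∀ x, ⊥ < f x

open Classical in
/-- Addition with `(+∞) + (-∞) = (-∞) + (+∞) = +∞` (in Mathlib this sum is `-∞`). -/
def upperAdd (a b : EReal) : EReal := if a = ⊤ ∨ b = ⊤ then ⊤ else a + b

open Classical in
/-- Multiplication by a real with `0 · (+∞) = +∞` and `0 · (-∞) = 0`
(in Mathlib `0 * ⊤ = 0`). -/
def upperMul (t : ℝ) (a : EReal) : EReal := if t = 0 ∧ a = ⊤ then ⊤ else (t : EReal) * a

open Classical in
/-- Finite sums with respect to `upperAdd`; see `upperSum_zero` and `upperSum_succ`. -/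
def upperSum {n : ℕ} (a : Fin n → EReal) : EReal := if ∃ k, a k = ⊤ then ⊤ else ∑ k, a k

theorem upperSum_zero (a : Fin 0 → EReal) : upperSum a = 0 := by
  simp [upperSum]

theorem upperSum_succ {n : ℕ} (a : Fin (n + 1) → EReal) :
    upperSum a = upperAdd (a 0) (upperSum fun k : Fin n => a k.succ) := by
  have key : ∀ {m : ℕ} (b : Fin m → EReal), (∀ k, b k ≠ ⊤) → ∑ k, b k ≠ ⊤ := by
    intro m b
    induction m with
    | zero => intro _; simp
    | succ m ih =>
      intro hb
      rw [Fin.sum_univ_succ]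
      exact EReal.add_ne_top (hb 0) (ih _ fun k => hb k.succ)
  by_cases h0 : a 0 = ⊤
  · have : ∃ k, a k = ⊤ := ⟨0, h0⟩
    simp [upperSum, upperAdd, this, h0]
  · by_cases h : ∃ k : Fin n, a k.succ = ⊤
    · have : ∃ k, a k = ⊤ := h.elim fun k hk => ⟨k.succ, hk⟩
      simp [upperSum, upperAdd, this, h]
    · have h' : ¬ ∃ k, a k = ⊤ := by
        rw [Fin.exists_fin_succ]
        exact fun hh => hh.elim h0 h
      have hs := key (fun k : Fin n => a k.succ) (fun k hk => h ⟨k, hk⟩)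
      simp only [upperSum, upperAdd, if_neg h, if_neg h']
      rw [if_neg (by tauto), Fin.sum_univ_succ]

/-- The combination `x ↦ ∑ k, l k · f k x`, with the above conventions. -/
def combo {X : Type*} {n : ℕ} (f : Fin n → X → EReal) (l : Fin n → ℝ) (x : X) : EReal :=
  upperSum fun k => upperMul (l k) (f k x)

end ExtConvex

end

/-!
The argument takes place in `ℝⁿ`, whatever the space `X`. The set of `t ∈ ℝⁿ` with `f x ≤ t` for
some `x` is convex, and if `m = inf max fₖ` is finite, then none of its points lies strictly below
`(m, …, m)` in every coordinate. Separating it from the open orthant below `(m, …, m)` gives weights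
`l ∈ Δₙ` with `m ≤ l · t` on the whole set. Where all `fₖ x` are finite, this says `m ≤ ∑ lₖ fₖ x`;
where some `fₖ x = +∞`, the combination is `+∞`; and where `fₖ x = -∞`, the `k`-th coordinate of
such a `t` may tend to `-∞`, which forces `lₖ = 0`, so that the convention `0 · (-∞) = 0` removes
the term.
-/

namespace ExtConvex

open scoped Matrix

section Weights

variable {ι : Type*} [Fintype ι]

theorem nonneg_of_forall_le_add_nsmul {G : Type*} [AddCommGroup G] [LinearOrder G]
    [IsOrderedAddMonoid G] [Archimedean G] {u a b : G} (h : ∀ n : ℕ, u ≤ a + n • b) : 0 ≤ b := by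
  by_contra! hb
  obtain ⟨n, hn⟩ := exists_lt_nsmul (neg_pos.2 hb) (a - u)
  rw [neg_nsmul, sub_lt_comm, sub_neg_eq_add] at hn
  exact (h n).not_gt hn

theorem inv_sum_smul_mem_stdSimplex {𝕜 : Type*} [Field 𝕜] [LinearOrder 𝕜] [IsStrictOrderedRing 𝕜]
    {c : ι → 𝕜} (hc : 0 < c) : (∑ k, c k)⁻¹ • c ∈ stdSimplex 𝕜 ι := by
  have hsum : 0 < ∑ k, c k := Fintype.sum_pos hc
  refine ⟨fun k => mul_nonneg (inv_nonneg.2 hsum.le) (hc.le k), ?_⟩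
  simp only [Pi.smul_apply, smul_eq_mul, ← Finset.mul_sum, inv_mul_cancel₀ hsum.ne']

theorem dotProduct_const_of_mem_stdSimplex {𝕜 : Type*} [Semiring 𝕜] [PartialOrder 𝕜] {l : ι → 𝕜}
    (hl : l ∈ stdSimplex 𝕜 ι) (r : 𝕜) : (l ⬝ᵥ fun _ => r) = r := by
  rw [dotProduct, ← Finset.sum_mul, hl.2, one_mul]

theorem nonneg_of_forall_dotProduct_le {R : Type*} [CommRing R] [LinearOrder R]
    [IsStrictOrderedRing R] [Archimedean R] {c a : ι → R} {u : R} (h : ∀ s ≤ a, c ⬝ᵥ s ≤ u) :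
    0 ≤ c := by
  classical
  intro k
  refine nonneg_of_forall_le_add_nsmul (u := -u) (a := -(c ⬝ᵥ a)) fun n => ?_
  have hle := h (a - n • Pi.single k 1)
    (sub_le_self a (nsmul_nonneg (Pi.single_nonneg.2 zero_le_one) n))
  rw [dotProduct_sub, dotProduct_smul, dotProduct_single_one] at hle
  linarith

theorem dotProduct_le_of_forall_lt {c a : ι → ℝ} {u : ℝ}
    (h : ∀ s : ι → ℝ, (∀ k, s k < a k) → c ⬝ᵥ s ≤ u) {s : ι → ℝ} (hs : s ≤ a) : c ⬝ᵥ s ≤ u := by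
  have hclosure : s ∈ closure (Set.univ.pi fun k => Set.Iio (a k)) := by
    simpa only [closure_pi_set, closure_Iio, Set.pi_univ_Iic, Set.mem_Iic] using hs
  have hclosed : IsClosed {t : ι → ℝ | c ⬝ᵥ t ≤ u} :=
    isClosed_le (continuous_const.dotProduct continuous_id) continuous_const
  have hsub : (Set.univ.pi fun k => Set.Iio (a k)) ⊆ {t | c ⬝ᵥ t ≤ u} :=
    fun t ht => h t fun k => ht k (Set.mem_univ k)
  exact closure_minimal hsub hclosed hclosure

theorem exists_dotProduct_separating_orthant {C : Set (ι → ℝ)} (hC : Convex ℝ C) {a : ι → ℝ}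
    (ha : ∀ t ∈ C, ∃ k, a k ≤ t k) :
    ∃ (c : ι → ℝ) (u : ℝ), (∀ s : ι → ℝ, (∀ k, s k < a k) → c ⬝ᵥ s < u) ∧
      ∀ t ∈ C, u ≤ c ⬝ᵥ t := by
  classical
  have hdisj : Disjoint (Set.univ.pi fun k => Set.Iio (a k)) C :=
    Set.disjoint_left.2 fun t ht htC =>
      let ⟨k, hk⟩ := ha t htC
      (ht k (Set.mem_univ k)).not_ge hk
  obtain ⟨φ, u, hS, hCu⟩ := geometric_hahn_banach_open (convex_pi fun k _ => convex_Iio (a k))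
    (isOpen_set_pi Set.finite_univ fun _ _ => isOpen_Iio) hC hdisj
  obtain ⟨c, hc⟩ := (dotProductEquiv ℝ ι).surjective φ.toLinearMap
  have hφ : ∀ t, c ⬝ᵥ t = φ t := fun t => LinearMap.congr_fun hc t
  exact ⟨c, u, fun s hs => (hφ s).trans_lt (hS s fun k _ => hs k),
    fun t ht => (hCu t ht).trans_eq (hφ t).symm⟩

theorem exists_stdSimplex_dotProduct_le [Nonempty ι] {C : Set (ι → ℝ)} (hC : Convex ℝ C)
    {a : ι → ℝ} (ha : ∀ t ∈ C, ∃ k, a k ≤ t k) :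
    ∃ l ∈ stdSimplex ℝ ι, ∀ t ∈ C, l ⬝ᵥ a ≤ l ⬝ᵥ t := by
  classical
  obtain rfl | ⟨t₀, ht₀⟩ := C.eq_empty_or_nonempty
  · exact ⟨_, single_mem_stdSimplex ℝ (Classical.arbitrary ι), fun _ => False.elim⟩
  obtain ⟨c, u, hlt, hCu⟩ := exists_dotProduct_separating_orthant hC ha
  have hle : ∀ s ≤ a, c ⬝ᵥ s ≤ u := fun s hs =>
    dotProduct_le_of_forall_lt (fun s hs => (hlt s hs).le) hs
  have hne : c ≠ 0 := by
    rintro rfl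
    have h₁ := hlt (a - 1) fun k => sub_one_lt (a k)
    have h₂ := hCu t₀ ht₀
    simp only [zero_dotProduct] at h₁ h₂
    exact h₁.not_ge h₂
  have hpos : 0 < c := (nonneg_of_forall_dotProduct_le hle).lt_of_ne' hne
  refine ⟨_, inv_sum_smul_mem_stdSimplex hpos, fun t ht => ?_⟩
  rw [smul_dotProduct, smul_dotProduct]
  exact smul_le_smul_of_nonneg_left ((hle a le_rfl).trans (hCu t ht))
    (inv_nonneg.2 (Finset.sum_nonneg fun k _ => hpos.le k))

theorem coe_dotProduct (l t : ι → ℝ) :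
    ((l ⬝ᵥ t : ℝ) : EReal) = ∑ k, (l k : EReal) * (t k : EReal) := by
  simp only [← EReal.coe_mul]
  exact map_sum (⟨⟨Real.toEReal, EReal.coe_zero⟩, EReal.coe_add⟩ : ℝ →+ EReal) _ _

theorem nonpos_of_eq_bot_of_forall_le_dotProduct {l : ι → ℝ} {m : ℝ} {a : ι → EReal}
    (ha : ∀ k, a k ≠ ⊤) (h : ∀ t : ι → ℝ, (∀ k, a k ≤ t k) → m ≤ l ⬝ᵥ t) {k : ι}
    (hk : a k = ⊥) : l k ≤ 0 := by
  classical
  set r : ι → ℝ := fun j => (a j).toReal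
  refine neg_nonneg.1 (nonneg_of_forall_le_add_nsmul (u := m) (a := l ⬝ᵥ r) fun n => ?_)
  have hle := h (r - n • Pi.single k 1) fun j => by
    obtain rfl | hj := eq_or_ne j k
    · exact hk ▸ bot_le
    · simpa [hj] using EReal.le_coe_toReal (ha j)
  rw [dotProduct_sub, dotProduct_smul, dotProduct_single_one] at hle
  rwa [neg_nsmul, ← sub_eq_add_neg]

theorem le_sum_coe_mul_of_forall_le_dotProduct {l : ι → ℝ} (hl : 0 ≤ l) {m : ℝ} {a : ι → EReal}
    (ha : ∀ k, a k ≠ ⊤) (h : ∀ t : ι → ℝ, (∀ k, a k ≤ t k) → m ≤ l ⬝ᵥ t) :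
    (m : EReal) ≤ ∑ k, (l k : EReal) * a k := by
  have hterm : ∀ k, (l k : EReal) * ((a k).toReal : EReal) = l k * a k := by
    intro k
    by_cases hk : a k = ⊥
    · have hlk : l k = 0 := (nonpos_of_eq_bot_of_forall_le_dotProduct ha h hk).antisymm (hl k)
      simp only [hlk, EReal.coe_zero, zero_mul]
    · rw [EReal.coe_toReal (ha k) hk]
  calc (m : EReal) ≤ ((l ⬝ᵥ fun k => (a k).toReal : ℝ) : EReal) :=
        EReal.coe_le_coe_iff.2 (h _ fun k => EReal.le_coe_toReal (ha k))
    _ = ∑ k, (l k : EReal) * a k := by simp only [coe_dotProduct, hterm]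

end Weights

section Combo

variable {X : Type*} {n : ℕ} {f : Fin n → X → EReal} {l : Fin n → ℝ}

theorem upperMul_eq_top_iff {t : ℝ} (ht : 0 ≤ t) {a : EReal} : upperMul t a = ⊤ ↔ a = ⊤ := by
  obtain rfl | hpos := ht.eq_or_lt
  · simp [upperMul]
  · induction a with
    | bot => simp [upperMul, EReal.coe_mul_bot_of_pos hpos]
    | coe r => simp [upperMul, ← EReal.coe_mul]
    | top => simp [upperMul, EReal.coe_mul_top_of_pos hpos]

theorem combo_eq_top (hl : 0 ≤ l) {x : X} {k : Fin n} (hx : f k x = ⊤) : combo f l x = ⊤ :=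
  if_pos ⟨k, (upperMul_eq_top_iff (hl k)).2 hx⟩

theorem combo_eq_sum (hl : 0 ≤ l) {x : X} (hx : ∀ k, f k x ≠ ⊤) :
    combo f l x = ∑ k, (l k : EReal) * f k x := by
  rw [combo, upperSum, if_neg fun ⟨k, hk⟩ => hx k ((upperMul_eq_top_iff (hl k)).1 hk)]
  exact Finset.sum_congr rfl fun k _ => if_neg fun h => hx k h.2

theorem combo_le_iSup (hl : l ∈ stdSimplex ℝ (Fin n)) (x : X) : combo f l x ≤ ⨆ k, f k x := by
  refine EReal.le_of_forall_lt_iff_le.1 fun r hr => ?_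
  have hlt : ∀ k, f k x < r := fun k => (le_iSup (fun k => f k x) k).trans_lt hr
  calc combo f l x = ∑ k, (l k : EReal) * f k x := combo_eq_sum hl.1 fun k => (hlt k).ne_top
    _ ≤ ∑ k, (l k : EReal) * (r : EReal) := Finset.sum_le_sum fun k _ =>
        mul_le_mul_of_nonneg_left (hlt k).le (EReal.coe_nonneg.2 (hl.1 k))
    _ = ((l ⬝ᵥ fun _ => r : ℝ) : EReal) := (coe_dotProduct l _).symm
    _ = r := congrArg _ (dotProduct_const_of_mem_stdSimplex hl r)

/-- The upward closure in `ℝⁿ` of the image of `x ↦ (f₁ x, …, fₙ x)`, through which separation in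
`ℝⁿ` is applied to the `fₖ`. A point where some `fₖ` is `⊤` contributes nothing, and where `fₖ` is
`⊥` the `k`-th coordinate is unconstrained. -/
def upperImage {ι : Type*} (f : ι → X → EReal) : Set (ι → ℝ) :=
  {t | ∃ x, ∀ k, f k x ≤ (t k : EReal)}

theorem convex_upperImage {ι : Type*} [AddCommGroup X] [Module ℝ X] {f : ι → X → EReal}
    (hf : ∀ k, IsConvex (f k)) : Convex ℝ (upperImage f) := by
  rintro t ⟨x, hx⟩ s ⟨y, hy⟩ a b ha hb hab
  refine ⟨a • x + b • y, fun k => ?_⟩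
  have hxk : (x, t k) ∈ epi (f k) := hx k
  have hyk : (y, s k) ∈ epi (f k) := hy k
  exact hf k hxk hyk ha hb hab

theorem exists_le_of_mem_upperImage {ι : Type*} [Finite ι] [Nonempty ι] {f : ι → X → EReal}
    {m : ℝ} (hm : ∀ x, (m : EReal) ≤ ⨆ k, f k x) {t : ι → ℝ} (ht : t ∈ upperImage f) :
    ∃ k, m ≤ t k := by
  obtain ⟨x, hx⟩ := ht
  obtain ⟨k, hk⟩ := exists_eq_ciSup_of_finite (f := fun k => f k x)
  exact ⟨k, EReal.coe_le_coe_iff.1 (((hm x).trans_eq hk.symm).trans (hx k))⟩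

theorem le_combo_of_forall_upperImage (hl : 0 ≤ l) {m : ℝ} (h : ∀ t ∈ upperImage f, m ≤ l ⬝ᵥ t)
    (x : X) : (m : EReal) ≤ combo f l x := by
  by_cases hx : ∃ k, f k x = ⊤
  · obtain ⟨k, hk⟩ := hx
    exact le_top.trans_eq (combo_eq_top hl hk).symm
  · push Not at hx
    rw [combo_eq_sum hl hx]
    exact le_sum_coe_mul_of_forall_le_dotProduct hl hx fun t ht => h t ⟨x, ht⟩

theorem exists_stdSimplex_coe_le_combo [AddCommGroup X] [Module ℝ X] [Nonempty (Fin n)]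
    (hconv : ∀ k, IsConvex (f k)) {m : ℝ} (hm : ∀ x, (m : EReal) ≤ ⨆ k, f k x) :
    ∃ l ∈ stdSimplex ℝ (Fin n), ∀ x, (m : EReal) ≤ combo f l x := by
  obtain ⟨l, hl, h⟩ := exists_stdSimplex_dotProduct_le (convex_upperImage hconv) (a := fun _ => m)
    fun _ => exists_le_of_mem_upperImage hm
  have hlm : (l ⬝ᵥ fun _ => m) = m := dotProduct_const_of_mem_stdSimplex hl m
  exact ⟨l, hl, le_combo_of_forall_upperImage hl.1 fun t ht => hlm ▸ h t ht⟩

theorem exists_stdSimplex_le_combo [AddCommGroup X] [Module ℝ X] [Nonempty (Fin n)]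
    (hconv : ∀ k, IsConvex (f k)) {m : EReal} (hm : ∀ x, m ≤ ⨆ k, f k x) :
    ∃ l ∈ stdSimplex ℝ (Fin n), ∀ x, m ≤ combo f l x := by
  have hvertex := single_mem_stdSimplex ℝ (Classical.arbitrary (Fin n))
  induction m with
  | bot => exact ⟨_, hvertex, fun _ => bot_le⟩
  | coe m => exact exists_stdSimplex_coe_le_combo hconv hm
  | top =>
    refine ⟨_, hvertex, fun x => ?_⟩
    obtain ⟨k, hk⟩ := exists_eq_ciSup_of_finite (f := fun k => f k x)
    exact (combo_eq_top hvertex.1 (hk.trans (top_le_iff.1 (hm x)))).ge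

end Combo

end ExtConvex

theorem mainTheorem4_general {X : Type*} [AddCommGroup X] [Module ℝ X] (n : ℕ) (hn : 1 ≤ n)
    (f : Fin n → X → EReal) (hconv : ∀ k, ExtConvex.IsConvex (f k)) :
    IsGreatest ((fun l : Fin n → ℝ => ⨅ x, ExtConvex.combo f l x) '' stdSimplex ℝ (Fin n))
      (⨅ x, ⨆ k, f k x) := by
  have : Nonempty (Fin n) := ⟨⟨0, hn⟩⟩
  have hle : ∀ l ∈ stdSimplex ℝ (Fin n), ⨅ x, ExtConvex.combo f l x ≤ ⨅ x, ⨆ k, f k x :=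
    fun l hl => iInf_mono (ExtConvex.combo_le_iSup hl)
  obtain ⟨l, hl, hge⟩ := ExtConvex.exists_stdSimplex_le_combo hconv (iInf_le _)
  exact ⟨⟨l, hl, (hle l hl).antisymm (le_iInf hge)⟩, Set.forall_mem_image.2 hle⟩

theorem mainTheorem4 {X : Type*} [AddCommGroup X] [Module ℝ X] [TopologicalSpace X]
    [IsTopologicalAddGroup X] [ContinuousSMul ℝ X] [LocallyConvexSpace ℝ X] [T2Space X]
    (n : ℕ) (hn : 1 ≤ n) (f : Fin n → X → EReal)
    (hconv : ∀ k, ExtConvex.IsConvex (f k))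
    (hdom : (ExtConvex.dom fun x => ⨆ k, f k x).Nonempty)
    (h : (∀ k, ExtConvex.IsProper (f k)) ∨ (∀ k, LowerSemicontinuous (f k))) :
    IsGreatest ((fun l : Fin n → ℝ => ⨅ x, ExtConvex.combo f l x) '' stdSimplex ℝ (Fin n))
      (⨅ x, ⨆ k, f k x) :=
  mainTheorem4_general n hn f hconv
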